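/- Theorem 4.5 (unimodality for $G_{m,n}$). For $n\ge 1$ let $W_n$ (the centipede) be the tree with vertices $a_1,\dots,a_n,b_1,\dots,b_n$ and edges $a_ib_i$ ($1\le i\le n$) and $b_ib_{i+1}$ ($1\le i\le n-1$). For $m,n\ge 2$ let $G_{m,n}$ be the tree obtained from the disjoint union of the centipedes $W_m$ (with vertices $a_i,b_i$) and $W_n$ (with vertices $u_j,v_j$ in place of $a_j,b_j$) by adding the edge $b_2v_2$. For a finite graph $G$, let $s_k$ be the number of sets of $k$ pairwise non-adjacent vertices of $G$, let $\alpha(G)$ be the largest $k$ with $s_k>0$, and let $I(G;x)=\sum_{k=0}^{\alpha(G)}s_kx^k$ be the independence polynomial of $G$. For all $m\ge 2$ and $n\ge 2$ the polynomial $I(G_{m,n};x)$ is unimodal, that is, its coefficients satisfy $$s_0\le s_1\le\dots\le s_k\ge s_{k+1}\ge\dots\ge s_{\alpha(G_{m,n})}$$ for some $k\in\{0,1,\dots,\alpha(G_{m,n})\}$. -/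

import Mathlib

open Polynomial

/-- The number `s_k` of stable (independent) sets of cardinality `k` in `G`. -/
noncomputable def numStable {V : Type*} (G : SimpleGraph V) (k : ℕ) : ℕ :=
  (G.indepSetSet k).ncard

/-- The independence polynomial `I(G; x) = ∑_{k=0}^{α(G)} s_k x^k` of a finite graph,
where `α(G) = G.indepNum` is the stability number. -/
noncomputable def indepPoly {V : Type*} [Finite V] (G : SimpleGraph V) : ℕ[X] :=
  ∑ k ∈ Finset.range (G.indepNum + 1), C (numStable G k) * X ^ k

/-- The finite sequence `a 0, a 1, ..., a n` of non-negative numbers is unimodal: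
`a 0 ≤ ... ≤ a k ≥ a (k + 1) ≥ ... ≥ a n` for some `k ∈ {0, ..., n}`. -/
def IsUnimodalSeq {R : Type*} [Zero R] [LE R] (n : ℕ) (a : ℕ → R) : Prop :=
  (∀ i ≤ n, 0 ≤ a i) ∧
    ∃ k ≤ n, (∀ i < k, a i ≤ a (i + 1)) ∧ (∀ i, k ≤ i → i < n → a (i + 1) ≤ a i)

/-- A polynomial is unimodal if the sequence of its coefficients, from the constant one to the
leading one, is unimodal. -/
def IsUnimodalPoly {R : Type*} [Semiring R] [LE R] (p : R[X]) : Prop :=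
  IsUnimodalSeq p.natDegree p.coeff

/-- The edge-join `(G₁; v₁) ⊖ (G₂; v₂)`: the disjoint union of `G₁` and `G₂` together with one
new edge, joining `v₁` and `v₂`. -/
def edgeJoin {V₁ V₂ : Type*} (G₁ : SimpleGraph V₁) (v₁ : V₁) (G₂ : SimpleGraph V₂) (v₂ : V₂) :
    SimpleGraph (V₁ ⊕ V₂) :=
  (G₁ ⊕g G₂) ⊔ SimpleGraph.edge (Sum.inl v₁) (Sum.inr v₂)

/-- The centipede `W_n` on the vertices `a_1, ..., a_n` (`Sum.inl`) and `b_1, ..., b_n`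
(`Sum.inr`), with edges `a_i b_i` for all `i` and `b_i b_{i+1}` for `i < n`. The vertices `a_i` and
`b_i` have the index `i - 1` in `Fin n`. -/
def centipede (n : ℕ) : SimpleGraph (Fin n ⊕ Fin n) :=
  SimpleGraph.fromEdgeSet
    ({e | ∃ i : Fin n, e = s(Sum.inl i, Sum.inr i)} ∪
      {e | ∃ i j : Fin n, (i : ℕ) + 1 = j ∧ e = s(Sum.inr i, Sum.inr j)})

/-- The second vertex `b_2` on the spine of the centipede `W_n`, `n ≥ 2`. -/
def spineTwo (n : ℕ) (hn : 2 ≤ n) : Fin n ⊕ Fin n :=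
  Sum.inr ⟨1, hn⟩

/-- The tree `G_{m,n} = (W_m; b_2) ⊖ (W_n; v_2)`. -/
def treeG (m n : ℕ) (hm : 2 ≤ m) (hn : 2 ≤ n) :
    SimpleGraph ((Fin m ⊕ Fin m) ⊕ (Fin n ⊕ Fin n)) :=
  edgeJoin (centipede m) (spineTwo m hm) (centipede n) (spineTwo n hn)

/-! The independence polynomial has only real roots, so by Newton its coefficients are log-concave
and hence unimodal. For the part of each centipede beyond `b_2` or `v_2`, let u, u' count all stable
sets and w, w' those avoiding the first spine vertex, weighted by powers of x. The polynomial is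
then (1+x)²(1+2x)·u·u'·(1 + 2x + xw/u + xw'/u') (`aeval_indepPoly_treeG`). If Im x > 0, each of xw/u
and xw'/u' has positive imaginary part (`centipedeSum_ratio`), so no factor vanishes. -/

/-! ### Real-rootedness, log-concavity and unimodality -/

/-- Log-concavity without internal zeros, in the form of an inequality between consecutive
`2 × 2` minors. -/
def StronglyLogConcave (a : ℕ → ℝ) : Prop :=
  ∀ i j, i ≤ j → a i * a (j + 2) ≤ a (i + 1) * a (j + 1)

/-- Expand in powers of b. The terms in 1 and b² are minors of `p`; the term in b needs a minor with
a wider gap, which two uses of the hypothesis at different pairs give. This is why all i ≤ j are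
allowed, not only i = j. -/
lemma StronglyLogConcave.mul_X_add_C {p : ℝ[X]} (hp : ∀ i, 0 ≤ p.coeff i)
    (h : StronglyLogConcave p.coeff) {b : ℝ} (hb : 0 ≤ b) :
    StronglyLogConcave (p * (X + C b)).coeff := by
  have h0 : (p * (X + C b)).coeff 0 = b * p.coeff 0 := by simp [mul_add, mul_comm]
  have hs (k : ℕ) : (p * (X + C b)).coeff (k + 1) = p.coeff k + b * p.coeff (k + 1) := by
    simp [mul_add, mul_comm]
  intro i j hij
  have h1 := mul_le_mul_of_nonneg_left (h i j hij) (mul_nonneg hb hb)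
  rcases i with _ | i
  · rw [h0, hs, hs, hs]
    have h2 : p.coeff 0 * p.coeff (j + 1) ≤ p.coeff 1 * p.coeff j := by
      rcases j with _ | j
      · exact (mul_comm _ _).le
      · exact h 0 j (Nat.zero_le _)
    have h3 := mul_nonneg (hp 0) (hp j)
    have h4 := mul_nonneg hb (mul_nonneg (hp 1) (hp j))
    simp only [zero_add] at *
    nlinarith
  · rw [hs, hs, hs, hs]
    obtain ⟨j, rfl⟩ : ∃ k, j = k + 1 := ⟨j - 1, by omega⟩
    have h2 := h i j (by omega)
    have h3 : p.coeff i * p.coeff (j + 3) ≤ p.coeff (i + 2) * p.coeff (j + 1) := by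
      refine (h i (j + 1) (by omega)).trans ?_
      rcases (show i ≤ j by omega).eq_or_lt with rfl | hlt
      · exact (mul_comm _ _).le
      · exact h (i + 1) j hlt
    have h4 := mul_le_mul_of_nonneg_left h3 hb
    nlinarith

lemma stronglyLogConcave_prod_X_add_C (m : Multiset ℝ) (hm : ∀ b ∈ m, 0 ≤ b) :
    (∀ i, 0 ≤ (m.map (X + C ·)).prod.coeff i) ∧
      StronglyLogConcave (m.map (X + C ·)).prod.coeff := by
  induction m using Multiset.induction_on with
  | empty =>
    constructor
    · intro i
      simp only [Multiset.map_zero, Multiset.prod_zero, coeff_one]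
      split_ifs <;> norm_num
    · intro i j _
      simp [coeff_one]
  | cons b m ih =>
    obtain ⟨h1, h2⟩ := ih fun c hc => hm c (Multiset.mem_cons_of_mem hc)
    have hb := hm b (Multiset.mem_cons_self b m)
    rw [Multiset.map_cons, Multiset.prod_cons, mul_comm]
    refine ⟨fun i => ?_, h2.mul_X_add_C h1 hb⟩
    rcases i with _ | i
    · simpa [mul_add] using mul_nonneg (h1 0) hb
    · simpa [mul_add] using add_nonneg (h1 i) (mul_nonneg (h1 (i + 1)) hb)

/-- Newton: a real polynomial with non-negative coefficients and only real roots has a log-concave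
coefficient sequence. -/
theorem stronglyLogConcave_of_splits {p : ℝ[X]} (hp : ∀ i, 0 ≤ p.coeff i) (hs : p.Splits) :
    StronglyLogConcave p.coeff := by
  rcases eq_or_ne p 0 with rfl | hp0
  · intro i j _
    simp
  have hroot : ∀ r ∈ p.roots, r ≤ 0 := by
    intro r hr
    by_contra! hpos
    have hev : p.eval r = 0 := (mem_roots'.1 hr).2
    rw [eval_eq_sum_range] at hev
    have hle := Finset.single_le_sum (f := fun i => p.coeff i * r ^ i)
      (fun i _ => mul_nonneg (hp i) (pow_nonneg hpos.le i)) (Finset.self_mem_range_succ p.natDegree)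
    rw [hev] at hle
    have hlead : 0 < p.coeff p.natDegree :=
      lt_of_le_of_ne (hp _) (Ne.symm (by simpa using hp0))
    exact absurd hle (not_le.2 (mul_pos hlead (pow_pos hpos _)))
  obtain ⟨_, h2⟩ := stronglyLogConcave_prod_X_add_C (p.roots.map (- ·)) (by
    intro b hb
    obtain ⟨r, hr, rfl⟩ := Multiset.mem_map.1 hb
    exact neg_nonneg.2 (hroot r hr))
  have heq : p = C p.leadingCoeff * ((p.roots.map (- ·)).map (X + C ·)).prod := by
    conv_lhs => rw [hs.eq_prod_roots]
    simp [Multiset.map_map, sub_eq_add_neg]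
  intro i j hij
  rw [heq]
  simp only [coeff_C_mul]
  have := mul_le_mul_of_nonneg_left (h2 i j hij) (mul_self_nonneg p.leadingCoeff)
  linarith

/-- Non-real roots come in conjugate pairs, so excluding the upper half-plane suffices. -/
lemma splits_of_aeval_ne_zero {p : ℝ[X]}
    (h : ∀ z : ℂ, 0 < z.im → aeval z p ≠ 0) : p.Splits := by
  refine Splits.of_splits_map (algebraMap ℝ ℂ) (IsAlgClosed.splits _) fun z hz => ?_
  have hz0 : aeval z p = 0 := by
    rw [aeval_def, ← eval_map]
    exact (mem_roots'.1 hz).2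
  rcases lt_trichotomy z.im 0 with him | him | him
  · refine absurd ?_ (h (starRingEnd ℂ z) (by simpa using him))
    rw [aeval_conj, hz0, map_zero]
  · exact ⟨z.re, Complex.ext (by simp) (by simp [him])⟩
  · exact absurd hz0 (h z him)

/-- The peak k is the first strict descent. After it, p_k p_{j+2} ≤ p_{k+1} p_{j+1} ≤ p_k p_{j+1},
and p_k > 0 cancels. -/
theorem isUnimodalPoly_of_stronglyLogConcave {p : ℕ[X]}
    (h : StronglyLogConcave fun i => (p.coeff i : ℝ)) : IsUnimodalPoly p := by
  classical
  refine ⟨fun _ _ => Nat.zero_le _, ?_⟩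
  have hex : ∃ k, k = p.natDegree ∨ p.coeff (k + 1) < p.coeff k := ⟨_, Or.inl rfl⟩
  refine ⟨Nat.find hex, Nat.find_min' hex (Or.inl rfl), fun i hi => ?_, fun i hki hin => ?_⟩
  · have := Nat.find_min hex hi
    push Not at this
    exact this.2
  · have hk := (Nat.find_spec hex).resolve_left (by omega)
    rcases hki.eq_or_lt with heq | hlt
    · rw [← heq]
      exact hk.le
    · obtain ⟨j, rfl⟩ : ∃ j, i = j + 1 := ⟨i - 1, by omega⟩
      have h1 := h _ j (Nat.lt_succ_iff.1 hlt)
      simp only at h1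
      norm_cast at h1
      have h2 := Nat.mul_le_mul_right (p.coeff (j + 1)) hk.le
      exact Nat.le_of_mul_le_mul_left (h1.trans h2) (by omega)

/-- A polynomial with natural coefficients and only real roots is unimodal. -/
theorem isUnimodalPoly_of_aeval_ne_zero {p : ℕ[X]}
    (h : ∀ z : ℂ, 0 < z.im → aeval z p ≠ 0) : IsUnimodalPoly p := by
  have hs : (p.map (Nat.castRingHom ℝ)).Splits := splits_of_aeval_ne_zero fun z hz => by
    have := h z hz
    rwa [aeval_def, eval₂_map, Subsingleton.elim ((algebraMap ℝ ℂ).comp (Nat.castRingHom ℝ))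
      (algebraMap ℕ ℂ), ← aeval_def]
  have := stronglyLogConcave_of_splits (fun i => by simp) hs
  exact isUnimodalPoly_of_stronglyLogConcave fun i j hij => by simpa using this i j hij

/-! ### Weighted counts of stable sets -/

open Classical in
/-- The weighted count `∑ x ^ |S|` of the stable sets `S` of `G` with the property `Q`, where `S` is
given by its indicator function. -/
noncomputable def stableSum {V R : Type*} [Fintype V] [DecidableEq V] [CommSemiring R]
    (G : SimpleGraph V)
    (Q : (V → Bool) → Prop) (x : R) : R :=
  ∑ σ : V → Bool, if (∀ u v, G.Adj u v → ¬(σ u ∧ σ v)) ∧ Q σ then ∏ v, (if σ v then x else 1) else 0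

lemma aeval_indepPoly {V R : Type*} [Fintype V] [DecidableEq V] [CommSemiring R]
    (G : SimpleGraph V) (x : R) :
    aeval x (indepPoly G) = stableSum G (fun _ => True) x := by
  classical
  have h1 : stableSum G (fun _ => True) x =
      ∑ S ∈ Finset.univ.filter (fun S : Finset V => G.IsIndepSet (S : Set V)), x ^ S.card := by
    rw [stableSum, Finset.sum_filter]
    refine (Fintype.sum_bijective (fun (S : Finset V) (v : V) => decide (v ∈ S))
      ⟨?_, ?_⟩ _ _ ?_).symm
    · intro S T h
      ext v
      simpa using congrFun h v
    · intro σ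
      exact ⟨Finset.univ.filter fun v => σ v, by ext; simp⟩
    · intro S
      have : G.IsIndepSet (S : Set V) ↔ ∀ u v, G.Adj u v → ¬(u ∈ S ∧ v ∈ S) := by
        constructor
        · rintro h u v huv ⟨hu, hv⟩
          exact h hu hv huv.ne huv
        · intro h u hu v hv _ huv
          exact h u v huv ⟨hu, hv⟩
      simp [this]
  have h2 : ∀ S ∈ Finset.univ.filter (fun S : Finset V => G.IsIndepSet (S : Set V)),
      S.card ∈ Finset.range (G.indepNum + 1) := by
    intro S hS
    exact Finset.mem_range_succ_iff.2 (Finset.mem_filter.1 hS).2.card_le_indepNum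
  rw [h1, ← Finset.sum_fiberwise_of_maps_to h2, indepPoly, map_sum]
  refine Finset.sum_congr rfl fun k _ => ?_
  rw [Finset.sum_congr rfl (g := fun _ => x ^ k) (by
    intro S hS
    rw [(Finset.mem_filter.1 hS).2])]
  have h3 : numStable G k = ((Finset.univ.filter (fun S : Finset V =>
      G.IsIndepSet (S : Set V))).filter fun S => S.card = k).card := by
    rw [numStable, ← Set.ncard_coe_finset]
    congr 1
    ext S
    simp [SimpleGraph.isNIndepSet_iff]
  simp [h3]

lemma ite_and_not_and {R : Type*} [CommRing R] (P Q A B : Prop) {_ : Decidable P} {_ : Decidable Q}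
    {_ : Decidable (P ∧ A)} {_ : Decidable (Q ∧ B)} {_ : Decidable ((P ∧ Q) ∧ ¬(A ∧ B))}
    (a b : R) :
    (if (P ∧ Q) ∧ ¬(A ∧ B) then a * b else 0) =
      (if P then a else 0) * (if Q then b else 0) -
        (if P ∧ A then a else 0) * (if Q ∧ B then b else 0) := by
  by_cases P <;> by_cases Q <;> by_cases A <;> by_cases B <;> simp [*]

/-- The new edge forbids exactly the pairs of stable sets that contain both of its ends. -/
lemma stableSum_edgeJoin {V₁ V₂ R : Type*} [Fintype V₁] [Fintype V₂] [DecidableEq V₁]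
    [DecidableEq V₂] [CommRing R]
    (G₁ : SimpleGraph V₁) (v₁ : V₁) (G₂ : SimpleGraph V₂) (v₂ : V₂) (x : R) :
    stableSum (edgeJoin G₁ v₁ G₂ v₂) (fun _ => True) x =
      stableSum G₁ (fun _ => True) x * stableSum G₂ (fun _ => True) x -
        stableSum G₁ (fun σ => σ v₁) x * stableSum G₂ (fun σ => σ v₂) x := by
  classical
  simp only [stableSum]
  rw [← (Equiv.sumArrowEquivProdArrow V₁ V₂ Bool).symm.sum_comp, Fintype.sum_mul_sum,
    Fintype.sum_mul_sum, Fintype.sum_prod_type, ← Finset.sum_sub_distrib]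
  refine Finset.sum_congr rfl fun σ _ => ?_
  rw [← Finset.sum_sub_distrib]
  refine Finset.sum_congr rfl fun τ _ => ?_
  have h : (∀ u v, (edgeJoin G₁ v₁ G₂ v₂).Adj u v →
      ¬((Equiv.sumArrowEquivProdArrow V₁ V₂ Bool).symm (σ, τ) u ∧
        (Equiv.sumArrowEquivProdArrow V₁ V₂ Bool).symm (σ, τ) v)) ↔
      ((∀ u v, G₁.Adj u v → ¬(σ u ∧ σ v)) ∧ (∀ u v, G₂.Adj u v → ¬(τ u ∧ τ v))) ∧
        ¬(σ v₁ ∧ τ v₂) := by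
    constructor
    · intro h
      refine ⟨⟨fun u v huv => h (.inl u) (.inl v) ?_, fun u v huv => h (.inr u) (.inr v) ?_⟩,
        h (.inl v₁) (.inr v₂) ?_⟩ <;> simp [edgeJoin, SimpleGraph.edge_adj, *]
    · rintro ⟨⟨h₁, h₂⟩, h₃⟩ (u | u) (v | v) huv
      · exact h₁ u v (by simpa [edgeJoin, SimpleGraph.edge_adj] using huv)
      · obtain ⟨rfl, rfl⟩ : u = v₁ ∧ v = v₂ := by
          simpa [edgeJoin, SimpleGraph.edge_adj, eq_comm] using huv
        exact h₃
      · obtain ⟨rfl, rfl⟩ : v₂ = u ∧ v₁ = v := by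
          simpa [edgeJoin, SimpleGraph.edge_adj, eq_comm] using huv
        exact fun hh => h₃ hh.symm
      · exact h₂ u v (by simpa [edgeJoin, SimpleGraph.edge_adj] using huv)
  simp only [h, and_true, Fintype.prod_sum_type, Equiv.sumArrowEquivProdArrow_symm_apply_inl,
    Equiv.sumArrowEquivProdArrow_symm_apply_inr]
  exact ite_and_not_and _ _ _ _ _ _

/-! ### Recurrences for centipedes -/

/-- `α` and `β` indicate which of the vertices `a_i`, `b_i` belong to a stable set of the
centipede. -/
def IsCentipedeStable {n : ℕ} (α β : Fin n → Bool) : Prop :=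
  (∀ i, ¬(α i ∧ β i)) ∧ ∀ i j : Fin n, (i : ℕ) + 1 = j → ¬(β i ∧ β j)

open Classical in
/-- The weighted count of the stable sets of the centipede whose trace on the spine has the
property `Q`. -/
noncomputable def centipedeSum {R : Type*} [CommSemiring R] (n : ℕ)
    (Q : (Fin n → Bool) → Prop) (x : R) : R :=
  ∑ β : Fin n → Bool, ∑ α : Fin n → Bool, if IsCentipedeStable α β ∧ Q β then
    ∏ i, ((if α i then x else 1) * (if β i then x else 1)) else 0

lemma stableSum_centipede {R : Type*} [CommSemiring R] (n : ℕ) (Q : (Fin n → Bool) → Prop) (x : R) :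
    stableSum (centipede n) (fun σ => Q fun i => σ (.inr i)) x = centipedeSum n Q x := by
  classical
  simp only [stableSum, centipedeSum]
  rw [← (Equiv.sumArrowEquivProdArrow (Fin n) (Fin n) Bool).symm.sum_comp, Fintype.sum_prod_type,
    Finset.sum_comm]
  refine Finset.sum_congr rfl fun β _ => Finset.sum_congr rfl fun α _ => ?_
  have h : (∀ u v, (centipede n).Adj u v →
      ¬((Equiv.sumArrowEquivProdArrow (Fin n) (Fin n) Bool).symm (α, β) u ∧
        (Equiv.sumArrowEquivProdArrow (Fin n) (Fin n) Bool).symm (α, β) v)) ↔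
      IsCentipedeStable α β := by
    constructor
    · intro h
      refine ⟨fun i => h (.inl i) (.inr i) ?_, fun i j hij => h (.inr i) (.inr j) ?_⟩
      · simp [centipede]
      · have : i ≠ j := by
          rintro rfl
          omega
        simp only [centipede, SimpleGraph.fromEdgeSet_adj]
        exact ⟨Or.inr ⟨i, j, hij, rfl⟩, by simpa using this⟩
    · rintro ⟨h₁, h₂⟩ u v huv
      rw [centipede, SimpleGraph.fromEdgeSet_adj] at huv
      rcases huv.1 with ⟨i, hi⟩ | ⟨i, j, hij, hi⟩
      · rcases Sym2.eq_iff.1 hi with ⟨rfl, rfl⟩ | ⟨rfl, rfl⟩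
        · exact h₁ i
        · exact fun hh => h₁ i hh.symm
      · rcases Sym2.eq_iff.1 hi with ⟨rfl, rfl⟩ | ⟨rfl, rfl⟩
        · exact h₂ i j hij
        · exact fun hh => h₂ i j hij hh.symm
  simp only [h, Fintype.prod_sum_type, Equiv.sumArrowEquivProdArrow_symm_apply_inl,
    Equiv.sumArrowEquivProdArrow_symm_apply_inr, Finset.prod_mul_distrib]
  rfl

/-- The stable set avoids `b_1`. -/
def AvoidsFirst {n : ℕ} (β : Fin n → Bool) : Prop := ∀ i : Fin n, (i : ℕ) = 0 → β i = false

lemma isCentipedeStable_cons {n : ℕ} (a b : Bool) (α β : Fin n → Bool) :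
    IsCentipedeStable (Fin.cons a α : Fin (n + 1) → Bool) (Fin.cons b β : Fin (n + 1) → Bool) ↔
      ¬(a ∧ b) ∧ (b → AvoidsFirst β) ∧ IsCentipedeStable α β := by
  simp only [IsCentipedeStable, Fin.forall_fin_succ, AvoidsFirst]
  simp
  tauto

/-- Split on `b_1`: if it is absent, `a_1` is free, which gives 1 + x; if present, it excludes `a_1`
and `b_2`. -/
lemma centipedeSum_succ {R : Type*} [CommSemiring R] (n : ℕ)
    (Q : (Fin (n + 1) → Bool) → Prop) (x : R) :
    centipedeSum (n + 1) Q x =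
      (1 + x) * centipedeSum n (fun β => Q (Fin.cons false β : Fin (n + 1) → Bool)) x +
        x * centipedeSum n
          (fun β => AvoidsFirst β ∧ Q (Fin.cons true β : Fin (n + 1) → Bool)) x := by
  classical
  have cons_eq (b : Bool) (β : Fin n → Bool) :
      Fin.consEquiv (fun _ => Bool) (b, β) = (Fin.cons b β : Fin (n + 1) → Bool) := rfl
  simp only [centipedeSum]
  rw [← (Fin.consEquiv fun _ => Bool).sum_comp, Fintype.sum_prod_type, Fintype.sum_bool, add_comm]
  congr 1
  · rw [Finset.mul_sum]
    refine Finset.sum_congr rfl fun β _ => ?_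
    rw [← (Fin.consEquiv fun _ => Bool).sum_comp, Fintype.sum_prod_type, Fintype.sum_bool,
      add_comm, add_mul, one_mul, Finset.mul_sum]
    congr 1 <;>
    · refine Finset.sum_congr rfl fun α _ => ?_
      simp only [cons_eq, isCentipedeStable_cons, Fin.prod_univ_succ, Fin.cons_zero,
        Fin.cons_succ]
      simp
  · rw [Finset.mul_sum]
    refine Finset.sum_congr rfl fun β _ => ?_
    rw [← (Fin.consEquiv fun _ => Bool).sum_comp, Fintype.sum_prod_type, Fintype.sum_bool,
      Finset.mul_sum, ← Finset.sum_add_distrib]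
    refine Finset.sum_congr rfl fun α _ => ?_
    simp only [cons_eq, isCentipedeStable_cons, Fin.prod_univ_succ, Fin.cons_zero,
      Fin.cons_succ]
    simp [and_assoc, and_left_comm]

lemma centipedeSum_congr {R : Type*} [CommSemiring R] {n : ℕ} {Q Q' : (Fin n → Bool) → Prop}
    (h : ∀ β, Q β ↔ Q' β) (x : R) : centipedeSum n Q x = centipedeSum n Q' x :=
  congrArg (centipedeSum n · x) (funext fun β => propext (h β))

lemma centipedeSum_false {R : Type*} [CommSemiring R] (n : ℕ) (x : R) :
    centipedeSum n (fun _ => False) x = 0 := by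
  simp [centipedeSum]

lemma centipedeSum_zero {R : Type*} [CommSemiring R] {Q : (Fin 0 → Bool) → Prop}
    (h : ∀ β, Q β) (x : R) : centipedeSum 0 Q x = 1 := by
  simp [centipedeSum, h, IsCentipedeStable]

lemma centipedeSum_succ_true {R : Type*} [CommSemiring R] (n : ℕ) (x : R) :
    centipedeSum (n + 1) (fun _ => True) x =
      (1 + x) * centipedeSum n (fun _ => True) x + x * centipedeSum n AvoidsFirst x := by
  rw [centipedeSum_succ]
  congr 2
  exact centipedeSum_congr (by simp) x

lemma centipedeSum_succ_avoidsFirst {R : Type*} [CommSemiring R] (n : ℕ) (x : R) :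
    centipedeSum (n + 1) AvoidsFirst x = (1 + x) * centipedeSum n (fun _ => True) x := by
  rw [centipedeSum_succ, centipedeSum_congr (Q' := fun _ => True),
    centipedeSum_congr (Q' := fun _ => False) (Q := fun β => AvoidsFirst β ∧ _),
    centipedeSum_false, mul_zero, add_zero]
  · intro β
    simp [AvoidsFirst]
  · intro β
    simp [AvoidsFirst]

/-- Choosing `b_2` gives x, excludes `a_2`, `b_1` and `b_3`, and leaves `a_1` free. -/
lemma centipedeSum_spineTwo {R : Type*} [CommSemiring R] (n : ℕ) (x : R) :
    centipedeSum (n + 2) (fun β => β ⟨1, by omega⟩) x =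
      x * (1 + x) * centipedeSum n AvoidsFirst x := by
  have h (b c : Bool) (β : Fin n → Bool) :
      (Fin.cons b (Fin.cons c β : Fin (n + 1) → Bool) : Fin (n + 2) → Bool) ⟨1, by omega⟩ = c := rfl
  rw [centipedeSum_succ, centipedeSum_succ, centipedeSum_succ]
  simp only [h]
  -- The adjacent vertices `b_1` and `b_2` cannot both be chosen.
  have h1 : centipedeSum n (fun β => AvoidsFirst β ∧
      AvoidsFirst (Fin.cons true β : Fin (n + 1) → Bool) ∧ True) x = 0 := by
    rw [← centipedeSum_false n x]
    refine centipedeSum_congr (fun β => ?_) x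
    simp [AvoidsFirst]
  rw [h1]
  simp [centipedeSum_false]
  ring

/-- The polynomial identity behind the theorem. -/
lemma aeval_indepPoly_treeG {R : Type*} [CommRing R] (m n : ℕ) (hm : 2 ≤ m + 2) (hn : 2 ≤ n + 2)
    (x : R) :
    aeval x (indepPoly (treeG (m + 2) (n + 2) hm hn)) =
      (1 + x) ^ 2 * (1 + 2 * x) *
        ((1 + 2 * x) * centipedeSum m (fun _ => True) x * centipedeSum n (fun _ => True) x +
          x * (centipedeSum m (fun _ => True) x * centipedeSum n AvoidsFirst x +
            centipedeSum m AvoidsFirst x * centipedeSum n (fun _ => True) x)) := by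
  have h (k : ℕ) (hk : 2 ≤ k + 2) : stableSum (centipede (k + 2)) (fun σ => σ (spineTwo _ hk)) x =
      x * (1 + x) * centipedeSum k AvoidsFirst x := by
    rw [← centipedeSum_spineTwo, ← stableSum_centipede]
    rfl
  have h' (k : ℕ) : stableSum (centipede (k + 2)) (fun _ => True) x =
      centipedeSum (k + 2) (fun _ => True) x :=
    stableSum_centipede (k + 2) (fun _ => True) x
  rw [aeval_indepPoly, treeG, stableSum_edgeJoin, h, h, h', h', centipedeSum_succ_true,
    centipedeSum_succ_true, centipedeSum_succ_avoidsFirst, centipedeSum_succ_true (n + 1),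
    centipedeSum_succ_true n, centipedeSum_succ_avoidsFirst]
  ring

/-! ### No zeros in the upper half-plane -/

lemma inv_im_neg {z : ℂ} (hz : 0 < z.im) : (z⁻¹).im < 0 := by
  rw [Complex.inv_im]
  have : z ≠ 0 := by
    rintro rfl
    simp at hz
  exact div_neg_of_neg_of_pos (neg_lt_zero.2 hz) (Complex.normSq_pos.2 this)

lemma inv_im_pos {z : ℂ} (hz : z.im < 0) : 0 < (z⁻¹).im := by
  rw [Complex.inv_im]
  have : z ≠ 0 := by
    rintro rfl
    simp at hz
  exact div_pos (neg_pos.2 hz) (Complex.normSq_pos.2 this)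

lemma ne_zero_of_im_pos {z : ℂ} (hz : 0 < z.im) : z ≠ 0 := by
  rintro rfl
  simp at hz

/-- For `x` in the upper half-plane the ratio of the two weighted counts stays in a region that
is stable under the recurrence. -/
lemma centipedeSum_ratio {x : ℂ} (hx : 0 < x.im) (n : ℕ) :
    centipedeSum n (fun _ => True) x ≠ 0 ∧
      0 < (x * centipedeSum n AvoidsFirst x / centipedeSum n (fun _ => True) x).im ∧
      (centipedeSum n AvoidsFirst x / centipedeSum n (fun _ => True) x / (1 + x)).im ≤ 0 := by
  have hx0 := ne_zero_of_im_pos hx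
  have hx1 : 0 < (1 + x).im := by simpa using hx
  have hx1' := ne_zero_of_im_pos hx1
  induction n with
  | zero =>
    rw [centipedeSum_zero (fun _ => trivial),
      centipedeSum_zero (Q := AvoidsFirst) fun _ i => i.elim0]
    refine ⟨one_ne_zero, by simpa using hx, ?_⟩
    rw [div_one, one_div]
    exact (inv_im_neg hx1).le
  | succ n ih =>
    obtain ⟨hu, h1, h2⟩ := ih
    rw [centipedeSum_succ_true, centipedeSum_succ_avoidsFirst]
    set u := centipedeSum n (fun _ => True) x
    set w := centipedeSum n AvoidsFirst x
    have hs : 0 < (1 + x + x * w / u).im := by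
      rw [Complex.add_im]
      exact add_pos hx1 h1
    have hs0 := ne_zero_of_im_pos hs
    have heq : (1 + x) * u + x * w = u * (1 + x + x * w / u) := by
      field_simp
    rw [heq]
    refine ⟨mul_ne_zero hu hs0, ?_, ?_⟩
    -- The second bound is carried along for this step: it makes x⁻¹ + w/(u(1+x)) lie in the lower
    -- half-plane, and inversion moves it to the upper one.
    · have : x * ((1 + x) * u) / (u * (1 + x + x * w / u)) = (x⁻¹ + w / u / (1 + x))⁻¹ := by
        rw [← heq]
        have h3 : x⁻¹ + w / u / (1 + x) = ((1 + x) * u + x * w) / (x * ((1 + x) * u)) := by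
          field_simp
        rw [h3, inv_div]
      rw [this]
      refine inv_im_pos ?_
      rw [Complex.add_im]
      linarith [inv_im_neg hx]
    -- Conversely, the first bound puts 1 + x + xw/u in the upper half-plane, and its inverse is the
    -- new second ratio.
    · have : (1 + x) * u / (u * (1 + x + x * w / u)) / (1 + x) = (1 + x + x * w / u)⁻¹ := by
        rw [mul_comm u, mul_div_mul_right _ _ hu, div_div_cancel_left' hx1']
      rw [this]
      exact (inv_im_neg hs).le

theorem theorem4p5 (m n : ℕ) (hm : 2 ≤ m) (hn : 2 ≤ n) :
    IsUnimodalPoly (indepPoly (treeG m n hm hn)) := by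
  obtain ⟨m, rfl⟩ : ∃ k, m = k + 2 := ⟨m - 2, by omega⟩
  obtain ⟨n, rfl⟩ : ∃ k, n = k + 2 := ⟨n - 2, by omega⟩
  refine isUnimodalPoly_of_aeval_ne_zero fun x hx => ?_
  obtain ⟨hu, h1, -⟩ := centipedeSum_ratio hx m
  obtain ⟨hu', h1', -⟩ := centipedeSum_ratio hx n
  rw [aeval_indepPoly_treeG]
  set u := centipedeSum m (fun _ => True) x
  set u' := centipedeSum n (fun _ => True) x
  set w := centipedeSum m AvoidsFirst x
  set w' := centipedeSum n AvoidsFirst x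
  have hx1 : 0 < (1 + x).im := by simpa using hx
  have hx2 : 0 < (1 + 2 * x).im := by simpa using hx
  have hs : 0 < (1 + 2 * x + x * w / u + x * w' / u').im := by
    rw [Complex.add_im, Complex.add_im]
    exact add_pos (add_pos hx2 h1) h1'
  have heq : (1 + 2 * x) * u * u' + x * (u * w' + w * u') =
      u * u' * (1 + 2 * x + x * w / u + x * w' / u') := by
    field_simp
    ring
  rw [heq]
  exact mul_ne_zero (mul_ne_zero (pow_ne_zero _ (ne_zero_of_im_pos hx1)) (ne_zero_of_im_pos hx2))
    (mul_ne_zero (mul_ne_zero hu hu') (ne_zero_of_im_pos hs))
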